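/- Let $q$ be a prime power, let $V$ be a finite-dimensional vector space over the finite field $\mathbb F_q$, and let $G\le GL(V)$ be a non-abelian subgroup that acts irreducibly on $V$ and is coprime, i.e. $\gcd(|G|,|V|)=1$. For $g\in G$ put $\operatorname{Supp}_V(g)=\dim V-\dim\{v\in V: gv=v\}$, and let $\operatorname{MinSupp}_V(G)=\min_{1\ne g\in G}\operatorname{Supp}_V(g)$. Let $\operatorname{Irr}(G)$ be the set of irreducible complex characters of $G$; for $\chi\in\operatorname{Irr}(G)$ let $Z(\chi)=\{g\in G: |\chi(g)|=\chi(1)\}$, and put $$\operatorname{mr}(G,\chi)=\max_{g\notin Z(\chi)}\frac{|\chi(g)|}{\chi(1)}\quad(\chi(1)\ne1),\qquad \operatorname{mr}(G)=\max_{\chi\in\operatorname{Irr}(G),\ \chi(1)\neq 1}\operatorname{mr}(G,\chi).$$ Then $$\operatorname{MinSupp}_V(G)\ \ge\ \frac{\dim V}{2}\bigl(1-\operatorname{mr}(G)\bigr).$$ Moreover, fix any injective homomorphism $\theta:\overline{\mathbb F}_q^{\times}\to\mathbb C^{\times}$, and let $\beta:G\to\mathbb C$ be the Brauer character of $V$ with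 respect to $\theta$, i.e. $\beta(g)=\sum_i\theta(\lambda_i)$, where $\lambda_1,\dots,\lambda_{\dim V}$ are the eigenvalues of $g$ in $\overline{\mathbb F}_q$ with multiplicity. If $\chi\in\operatorname{Irr}(G)$ is any irreducible constituent of $\beta$, i.e. $\frac1{|G|}\sum_{g\in G}\chi(g)\overline{\beta(g)}\ne0$, then $$\operatorname{MinSupp}_V(G)\ \ge\ \frac12\Bigl(\chi(1)-\max_{g\notin Z(\chi)}|\chi(g)|\Bigr).$$ -/

import Mathlib

noncomputable section

namespace CoprimeLinear

open Module

/-- The natural representation on `V` of a linear group `G ≤ GL(V)`. -/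
def natRep {K V : Type*} [Field K] [AddCommGroup V] [Module K V]
    (G : Subgroup (LinearMap.GeneralLinearGroup K V)) : Representation K G V :=
  (Units.coeHom (V →ₗ[K] V)).comp G.subtype

/-- The fixed-point space `Fix(g) = {v ∈ V | g v = v}`. -/
def fixSpace {K V : Type*} [Field K] [AddCommGroup V] [Module K V]
    (g : LinearMap.GeneralLinearGroup K V) : Submodule K V :=
  LinearMap.eqLocus (g : V →ₗ[K] V) LinearMap.id

/-- The support `Supp(g) = dim V - dim Fix(g)` (the subtraction never truncates
for finite-dimensional `V`). -/
def supp {K V : Type*} [Field K] [AddCommGroup V] [Module K V]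
    (g : LinearMap.GeneralLinearGroup K V) : ℕ :=
  finrank K V - finrank K (fixSpace g)

/-- The minimum support of a (nontrivial) linear group: the minimum of `Supp(g)`
over the non-identity elements `g` of `G`. -/
def minSupp {K V : Type*} [Field K] [AddCommGroup V] [Module K V]
    (G : Subgroup (LinearMap.GeneralLinearGroup K V)) : ℕ :=
  sInf {s | ∃ g ∈ G, g ≠ 1 ∧ s = supp g}

/-- The set `Irr(G)` of irreducible complex characters of `G`. -/
def Irr (G : Type*) [Group G] : Set (G → ℂ) :=
  {χ | ∃ (n : ℕ) (ρ : Representation ℂ G (Fin n → ℂ)), ρ.IsIrreducible ∧ χ = ρ.character}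

/-- The center `Z(χ) = {g | |χ(g)| = χ(1)}` of a character. -/
def charCenter {G : Type*} [Group G] (χ : G → ℂ) : Set G :=
  {g | (‖χ g‖ : ℂ) = χ 1}

/-- `max_{g ∉ Z(χ)} |χ(g)|`. -/
def maxOffCenter {G : Type*} [Group G] (χ : G → ℂ) : ℝ :=
  sSup {r | ∃ g : G, g ∉ charCenter χ ∧ r = ‖χ g‖}

/-- The maximal character ratio `mr(G, χ) = max_{g ∉ Z(χ)} |χ(g)| / χ(1)`. -/
def mrChar {G : Type*} [Group G] (χ : G → ℂ) : ℝ :=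
  sSup {r | ∃ g : G, g ∉ charCenter χ ∧ r = ‖χ g‖ / (χ 1).re}

/-- The maximal character ratio `mr(G)`: the maximum of `mr(G, χ)` over the nonlinear
irreducible characters `χ` of `G`. -/
def mr (G : Type*) [Group G] : ℝ :=
  sSup {r | ∃ χ ∈ Irr G, χ 1 ≠ 1 ∧ r = mrChar χ}

/-- The inner product `(1/|G|) ∑_g φ(g) conj(ψ(g))` of complex functions on a finite group. -/
def classInner {G : Type*} [Group G] (φ ψ : G → ℂ) : ℂ :=
  (Nat.card G : ℂ)⁻¹ * ∑ᶠ g : G, φ g * (starRingEnd ℂ) (ψ g)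

/-- The Brauer character of `G ≤ GL(V)` on `V`, when `K` is a finite field and every element
of `G` has order prime to the characteristic: at `g`, lift each eigenvalue of `g` in the
algebraic closure of `K` to a complex root of unity by `θ`, and add the lifts with algebraic
multiplicity. Here `θ` is an embedding of the multiplicative group of the algebraic closure
into the one of `ℂ`, extended by `θ 0 = 0`. -/
def brauerCharacter {K V : Type*} [Field K] [AddCommGroup V] [Module K V]
    [FiniteDimensional K V] (G : Subgroup (LinearMap.GeneralLinearGroup K V))
    (θ : AlgebraicClosure K →*₀ ℂ) (g : G) : ℂ :=
  ((((natRep G g).charpoly.map (algebraMap K (AlgebraicClosure K))).roots).map θ).sum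

end CoprimeLinear

end

namespace CoprimeLinear

open Polynomial IsLocalRing

/-! ### Lifting idempotent matrices from the residue field of a local ring -/

section IdempotentLifting

variable {R : Type*} [CommRing R] [IsLocalRing R]

/-! Since |G| is prime to the characteristic, V lifts to a complex representation U of the same
dimension whose character is the Brauer character. Geometric multiplicity is at most algebraic
multiplicity, so g fixes on U a space at least as large as on V, whence Supp_U(g) ≤ Supp_V(g). On a
complex representation W, the eigenvalues of g are roots of unity, so its trace has absolute value
at least dim W - 2 Supp_W(g); and Supp_W(g) ≤ Supp_U(g) when W embeds in U
(`norm_trace_ge_of_injective`).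

Let W be an irreducible constituent of U with character χ, and g ≠ 1. If g ∉ Z(χ), this lower bound
on |χ(g)| is the second inequality. If g ∈ Z(χ), then g is scalar on W. A normal subgroup trivial on
W has nonzero fixed vectors on U, hence on V, hence is trivial because V is irreducible. So W is
faithful, g is central in G, the normal subgroup it generates fixes no nonzero vector, and Supp_V(g)
= dim V, which is more than enough (`IsFaithfulLift.supp_eq_finrank`).

For the first inequality, one may therefore assume that g lies outside Z(χ) for every constituent χ.
All these χ are then nonlinear, and |χ(g)| ≤ mr(G) χ(1) adds up to |U(g)| ≤ mr(G) dim V, to be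
compared with |U(g)| ≥ dim V - 2 Supp_V(g).

The lift is made over a valuation ring of ℂ. Completeness is replaced by the fact that monic
polynomials split over this ring, which is enough to lift idempotents (`exists_idempotent_lift`) and
hence summands of free modules over the group ring (`exists_representation_lift`). -/

theorem isUnit_of_residue_ne_zero {r : R} (h : residue R r ≠ 0) : IsUnit r := by
  by_contra hr
  exact h (by rwa [residue_eq_zero_iff, mem_maximalIdeal, mem_nonunits_iff])

/-- Roots are sorted by residue: those over 0 go into f, those over 1 into h, and differences across
the two classes are units. -/
theorem exists_coprime_factorization (s : Multiset R)
    (hs : ∀ r ∈ s, residue R r = 0 ∨ residue R r = 1) :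
    ∃ f h : R[X], f * h = X * (X - C 1) * (s.map (fun r => X - C r)).prod ∧ IsCoprime f h ∧
      residue R (f.eval 0) = 0 ∧ residue R (h.eval 1) = 0 := by
  have key : ∀ {a b : R}, residue R a = 0 → residue R b = 1 → IsCoprime (X - C a) (X - C b) :=
    fun {a b} ha hb => isCoprime_X_sub_C_of_isUnit_sub
      (isUnit_of_residue_ne_zero (by simp [ha, hb]))
  suffices H : ∃ f h : R[X], f * h = X * (X - C 1) * (s.map (fun r => X - C r)).prod ∧
      IsCoprime f h ∧ residue R (f.eval 0) = 0 ∧ residue R (h.eval 1) = 0 ∧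
      (∀ b, residue R b = 1 → IsCoprime f (X - C b)) ∧
      (∀ a, residue R a = 0 → IsCoprime (X - C a) h) by
    obtain ⟨f, h, h1, h2, h3, h4, -⟩ := H
    exact ⟨f, h, h1, h2, h3, h4⟩
  induction s using Multiset.induction_on with
  | empty =>
    -- The extra factor X(X - 1) makes f vanish at 0 and h at 1 in the residue field, even if `s`
    -- misses one of the two classes.
    refine ⟨X - C 0, X - C 1, by simp, key (by simp) (by simp), by simp, by simp,
      fun b hb => key (by simp) hb, fun a ha => key ha (by simp)⟩
  | cons r s ih =>
    obtain ⟨f, h, h1, h2, h3, h4, h5, h6⟩ := ih fun x hx => hs x (Multiset.mem_cons_of_mem hx)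
    rcases hs r (Multiset.mem_cons_self r s) with hr | hr
    · refine ⟨(X - C r) * f, h, ?_, (h6 r hr).mul_left h2, by simp [h3], h4,
        fun b hb => (key hr hb).mul_left (h5 b hb), h6⟩
      rw [Multiset.map_cons, Multiset.prod_cons, mul_assoc, h1]; ring
    · refine ⟨f, (X - C r) * h, ?_, (h5 r hr).mul_right h2, h3, by simp [h4],
        h5, fun a ha => (key ha hr).mul_right (h6 a ha)⟩
      rw [Multiset.map_cons, Multiset.prod_cons, mul_left_comm, h1]; ring

theorem aeval_of_isIdempotentElem {k A : Type*} [CommRing k] [Ring A] [Algebra k A] {e : A}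
    (he : IsIdempotentElem e) (p : k[X]) :
    aeval e p = p.eval 0 • (1 - e) + p.eval 1 • e := by
  induction p using Polynomial.induction_on' with
  | add p q hp hq => rw [map_add, hp, hq, eval_add, eval_add, add_smul, add_smul]; abel
  | monomial n a =>
    rw [aeval_monomial, Algebra.algebraMap_eq_smul_one, smul_mul_assoc, one_mul]
    rcases Nat.eq_zero_or_pos n with rfl | hn
    · simp [← smul_add]
    · simp [he.pow_eq hn.ne', hn.ne']

variable {ι : Type*} [Fintype ι] [DecidableEq ι]

theorem commute_aeval {k A : Type*} [CommRing k] [Ring A] [Algebra k A] {a b : A}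
    (h : Commute a b) (p : k[X]) : Commute (aeval a p) b := by
  induction p using Polynomial.induction_on' with
  | add p q hp hq => rw [map_add]; exact hp.add_left hq
  | monomial n r =>
    rw [aeval_monomial]
    exact (Algebra.commute_algebraMap_left r b).mul_left (h.pow_left n)

theorem map_aeval_residue (A : Matrix ι ι R) (p : R[X]) :
    (aeval A p).map (residue R) = aeval (A.map (residue R)) (p.map (residue R)) := by
  have h := Polynomial.map_aeval_eq_aeval_map (R := R) (S := Matrix ι ι R)
    (T := ResidueField R) (U := Matrix ι ι (ResidueField R)) (φ := residue R)
    (ψ := (residue R).mapMatrix) (by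
      ext r i j
      by_cases h : i = j <;> simp [Matrix.algebraMap_matrix_apply, h]) p A
  simpa using h

/-- With uf + vh = 1 and (fh)(A) = 0 by Cayley–Hamilton, (uf)(A) is idempotent. Modulo the maximal
ideal, uf takes the values 0 at 0 and 1 at 1, so it fixes the idempotent reduction of A. Being a
polynomial in A, the lift commutes with whatever commutes with A. -/
theorem exists_idempotent_lift [IsDomain R] (A : Matrix ι ι R) (hsplit : A.charpoly.Splits)
    (hA : IsIdempotentElem (A.map (residue R))) :
    ∃ p : R[X], IsIdempotentElem (aeval A p) ∧
      (aeval A p).map (residue R) = A.map (residue R) := by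
  have hroots : ∀ r ∈ A.charpoly.roots, residue R r = 0 ∨ residue R r = 1 := by
    intro r hr
    have h1 : (A.map (residue R)).charpoly.IsRoot (residue R r) := by
      rw [Matrix.charpoly_map]
      exact (isRoot_of_mem_roots hr).map
    rw [← Matrix.mem_spectrum_iff_isRoot_charpoly] at h1
    exact hA.spectrum_subset _ h1
  obtain ⟨f, h, hfh, ⟨u, v, huv⟩, hf, hh⟩ := exists_coprime_factorization _ hroots
  rw [← hsplit.eq_prod_roots_of_monic A.charpoly_monic] at hfh
  have hfh0 : aeval A (f * h) = 0 := by
    rw [hfh, map_mul, Matrix.aeval_self_charpoly, mul_zero]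
  refine ⟨u * f, ?_, ?_⟩
  · have e : u * f * (u * f) = u * f - u * v * (f * h) := by
      linear_combination (u * f) * huv
    rw [IsIdempotentElem, ← map_mul, e, map_sub, map_mul _ (u * v), hfh0, mul_zero, sub_zero]
  · have e0 : ((u * f).map (residue R)).eval 0 = 0 := by
      rw [← map_zero (residue R), eval_map_apply]; simp [hf]
    have e1 : ((u * f).map (residue R)).eval 1 = 1 := by
      rw [← map_one (residue R), eval_map_apply, eq_sub_of_add_eq huv]; simp [hh]
    rw [map_aeval_residue, aeval_of_isIdempotentElem hA, e0, e1, zero_smul, one_smul, zero_add]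

theorem exists_map_residue_eq {a b : Type*} (M : Matrix a b (ResidueField R)) :
    ∃ M' : Matrix a b R, M'.map (residue R) = M := by
  choose F hF using residue_surjective (R := R)
  exact ⟨M.map F, by ext; simp [hF]⟩

theorem isUnit_of_isUnit_map_residue {A : Matrix ι ι R} (hA : IsUnit (A.map (residue R))) :
    IsUnit A := by
  rw [Matrix.isUnit_iff_isUnit_det] at hA ⊢
  apply isUnit_of_residue_ne_zero
  rw [RingHom.map_det]
  exact hA.ne_zero

theorem isUnit_of_map_residue_eq_one {A : Matrix ι ι R} (hA : A.map (residue R) = 1) :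
    IsUnit A :=
  isUnit_of_isUnit_map_residue (hA ▸ isUnit_one)

theorem eq_zero_of_isIdempotentElem_of_map_residue {A : Matrix ι ι R} (hA : IsIdempotentElem A)
    (h0 : A.map (residue R) = 0) : A = 0 := by
  have hu : IsUnit (1 - A) := isUnit_of_map_residue_eq_one (by
    rw [Matrix.map_sub _ (map_sub _), h0, sub_zero]; simp)
  have : (1 - A) * A = 0 := by rw [sub_mul, one_mul, hA.eq, sub_self]
  exact hu.mul_right_eq_zero.mp this

end IdempotentLifting

/-! ### Lifting representations as summands of free modules over the group ring -/

section RepresentationLifting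

variable {R : Type*} [CommRing R]
  {G : Type*} [Group G] [DecidableEq G] {ι : Type*} [DecidableEq ι]

/-- The matrix of left translation by `g` on `|ι|` copies of the regular representation. -/
def freeRepMatrix (R ι : Type*) [CommRing R] [DecidableEq ι] {G : Type*} [Group G] [DecidableEq G]
    (g : G) : Matrix (ι × G) (ι × G) R :=
  Matrix.of fun a b => if a.1 = b.1 ∧ a.2 = g * b.2 then 1 else 0

variable [Fintype G] [Fintype ι]

theorem freeRepMatrix_mul {κ : Type*} (g : G) (M : Matrix (ι × G) κ R) (i : ι) (x : G) (c : κ) :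
    (freeRepMatrix R ι g * M) (i, x) c = M (i, g⁻¹ * x) c := by
  rw [Matrix.mul_apply, Finset.sum_eq_single (i, g⁻¹ * x)]
  · simp [freeRepMatrix]
  · rintro ⟨i', x'⟩ - hne
    rw [freeRepMatrix, Matrix.of_apply, if_neg, zero_mul]
    rintro ⟨h1, h2⟩
    exact hne (Prod.ext h1.symm (eq_inv_mul_of_mul_eq h2.symm))
  · simp

theorem mul_freeRepMatrix {κ : Type*} (g : G) (M : Matrix κ (ι × G) R) (i : ι) (x : G) (c : κ) :
    (M * freeRepMatrix R ι g) c (i, x) = M c (i, g * x) := by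
  rw [Matrix.mul_apply, Finset.sum_eq_single (i, g * x)]
  · simp [freeRepMatrix]
  · rintro ⟨i', x'⟩ - hne
    rw [freeRepMatrix, Matrix.of_apply, if_neg, mul_zero]
    rintro ⟨h1, h2⟩
    exact hne (Prod.ext h1 h2)
  · simp

/-- Over a local domain in which monic polynomials split, representations of a finite group of
order invertible in the residue field lift from the residue field. -/
theorem exists_representation_lift [IsLocalRing R] [IsDomain R]
    (hsplit : ∀ f : R[X], f.Monic → f.Splits)
    (τ : G →* Matrix ι ι (ResidueField R)) (hcard : (Fintype.card G : ResidueField R) ≠ 0) :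
    ∃ ρ : G →* Matrix ι ι R, ∀ g, (ρ g).map (residue R) = τ g := by
  set k := ResidueField R
  -- Maschke: τ is a direct summand of a free module, with equivariant inclusion `s` and retraction
  -- `q`.
  let s : Matrix (ι × G) ι k := Matrix.of fun a j =>
    (Fintype.card G : k)⁻¹ * τ a.2⁻¹ a.1 j
  let q : Matrix ι (ι × G) k := Matrix.of fun j a => τ a.2 j a.1
  have hqs : q * s = 1 := by
    ext i j
    have : ∀ x : G, ∑ l, τ x i l * ((Fintype.card G : k)⁻¹ * τ x⁻¹ l j) =
        (Fintype.card G : k)⁻¹ * (1 : Matrix ι ι k) i j := by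
      intro x
      rw [← map_one τ, ← mul_inv_cancel x, map_mul, Matrix.mul_apply, Finset.mul_sum]
      exact Finset.sum_congr rfl fun l _ => by ring
    rw [Matrix.mul_apply, Fintype.sum_prod_type_right]
    simp only [s, q, Matrix.of_apply, this]
    rw [Finset.sum_const, Finset.card_univ, nsmul_eq_mul, mul_inv_cancel_left₀ hcard]
  have hΓs : ∀ g, freeRepMatrix k ι g * s = s * τ g := by
    intro g
    ext ⟨i, x⟩ j
    rw [freeRepMatrix_mul, Matrix.mul_apply]
    simp only [s, Matrix.of_apply]
    simp [mul_assoc, ← Finset.mul_sum, Matrix.mul_apply]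
  -- Entries of `s * q` depend only on x⁻¹y. Lifting one matrix per group element keeps this shape,
  -- so `A` commutes exactly with translations.
  choose c hc using fun g : G => exists_map_residue_eq ((Fintype.card G : k)⁻¹ • τ g)
  let A : Matrix (ι × G) (ι × G) R := Matrix.of fun a b => c (a.2⁻¹ * b.2) a.1 b.1
  have hAres : A.map (residue R) = s * q := by
    ext ⟨i, x⟩ ⟨j, y⟩
    have h1 := congrFun (congrFun (hc (x⁻¹ * y)) i) j
    rw [Matrix.mul_apply]
    simp only [Matrix.map_apply] at h1
    simp only [A, s, q, Matrix.of_apply, Matrix.map_apply, h1, Matrix.smul_apply, map_mul,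
      Matrix.mul_apply, mul_assoc, ← Finset.mul_sum, smul_eq_mul]
  have hAΓ : ∀ g, Commute A (freeRepMatrix R ι g) := by
    intro g
    ext ⟨i, x⟩ ⟨j, y⟩
    rw [freeRepMatrix_mul, mul_freeRepMatrix]
    simp [A, mul_assoc]
  obtain ⟨p, hE, hEres⟩ := exists_idempotent_lift A (hsplit _ A.charpoly_monic) (by
    rw [hAres, IsIdempotentElem, Matrix.mul_assoc, ← Matrix.mul_assoc q, hqs, Matrix.one_mul])
  set E := aeval A p
  have hEΓ : ∀ g, E * freeRepMatrix R ι g = freeRepMatrix R ι g * E := fun g =>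
    (commute_aeval (hAΓ g) p).eq
  obtain ⟨S₀, hS₀⟩ := exists_map_residue_eq s
  obtain ⟨Q, hQ⟩ := exists_map_residue_eq q
  set S := E * S₀ with hS
  have hES : E * S = S := by rw [hS, ← Matrix.mul_assoc, hE.eq]
  have hSres : S.map (residue R) = s := by
    rw [hS, Matrix.map_mul, hEres, hAres, hS₀, Matrix.mul_assoc, hqs, Matrix.mul_one]
  have hu : IsUnit (Q * S) := isUnit_of_map_residue_eq_one (by
    rw [Matrix.map_mul, hQ, hSres, hqs])
  obtain ⟨U, hU⟩ := hu.exists_left_inv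
  have hUres : U.map (residue R) = 1 := by
    have := congrArg (fun M : Matrix ι ι R => M.map (residue R)) hU
    simp only [Matrix.map_mul, hQ, hSres, hqs, Matrix.mul_one] at this
    rw [this]; simp
  set T := U * Q * E with hT
  have hTS : T * S = 1 := by rw [hT, Matrix.mul_assoc, hES, Matrix.mul_assoc, hU]
  have hTE : T * E = T := by rw [hT, Matrix.mul_assoc, hE.eq]
  have hTres : T.map (residue R) = q := by
    rw [hT, Matrix.map_mul, Matrix.map_mul, hEres, hAres, hUres, hQ, Matrix.one_mul,
      ← Matrix.mul_assoc, hqs, Matrix.one_mul]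
  -- `E - S * T` is an idempotent reducing to 0, hence 0. So `S` and `T` identify the image of `E`
  -- with a free module of rank |ι|, on which translations act.
  have hST : S * T = E := by
    have hD : IsIdempotentElem (E - S * T) := by
      have h1 : E * (S * T) = S * T := by rw [← Matrix.mul_assoc, hES]
      have h2 : S * T * E = S * T := by rw [Matrix.mul_assoc, hTE]
      have h3 : S * T * (S * T) = S * T := by
        rw [Matrix.mul_assoc, ← Matrix.mul_assoc T, hTS, Matrix.one_mul]
      rw [IsIdempotentElem, sub_mul, mul_sub, mul_sub, hE.eq, h1, h2, h3, sub_self, sub_zero]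
    refine (sub_eq_zero.mp (eq_zero_of_isIdempotentElem_of_map_residue hD ?_)).symm
    rw [Matrix.map_sub _ (map_sub _), Matrix.map_mul, hEres, hAres, hSres, hTres, sub_self]
  have hΓmul : ∀ g h : G, freeRepMatrix R ι (g * h) =
      freeRepMatrix R ι g * freeRepMatrix R ι h := by
    intro g h
    ext ⟨i, x⟩ ⟨j, y⟩
    rw [freeRepMatrix_mul]
    simp [freeRepMatrix, mul_assoc, inv_mul_eq_iff_eq_mul]
  refine ⟨⟨⟨fun g => T * freeRepMatrix R ι g * S, ?_⟩, fun g h => ?_⟩, fun g => ?_⟩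
  · have : freeRepMatrix R ι (1 : G) = 1 := by
      ext ⟨i, x⟩ ⟨j, y⟩
      simp [freeRepMatrix, Matrix.one_apply]
    rw [this, Matrix.mul_one, hTS]
  · change T * freeRepMatrix R ι (g * h) * S =
      T * freeRepMatrix R ι g * S * (T * freeRepMatrix R ι h * S)
    calc T * freeRepMatrix R ι (g * h) * S
        = T * freeRepMatrix R ι g * (freeRepMatrix R ι h * (E * S)) := by
          rw [hES, hΓmul]; simp only [Matrix.mul_assoc]
      _ = T * freeRepMatrix R ι g * (S * T * freeRepMatrix R ι h * S) := by
          rw [hST, hEΓ]; simp only [Matrix.mul_assoc]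
      _ = _ := by simp only [Matrix.mul_assoc]
  · change (T * freeRepMatrix R ι g * S).map _ = _
    have : (freeRepMatrix R ι g).map (residue R) = freeRepMatrix k ι g := by
      ext a b
      simp [freeRepMatrix, apply_ite]
    rw [Matrix.map_mul, Matrix.map_mul, hTres, this, hSres, Matrix.mul_assoc, hΓs,
      ← Matrix.mul_assoc, hqs, Matrix.one_mul]

end RepresentationLifting

end CoprimeLinear

namespace CoprimeLinear

open Polynomial IsLocalRing

/-! ### Valuation rings of an algebraically closed field, with prescribed reduction of roots of
unity -/

section ValuationRing

/-- Roots of a monic polynomial are integral, and valuation rings are integrally closed. -/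
theorem valuationSubring_splits {K : Type*} [Field K] [IsAlgClosed K] (R : ValuationSubring K)
    (f : R[X]) (hf : f.Monic) : f.Splits := by
  refine Splits.of_splits_map_of_injective (i := algebraMap R K) Subtype.val_injective
    (IsAlgClosed.splits _) fun a ha => ?_
  have : IsIntegral R a := ⟨f, hf, by
    rw [eval₂_eq_eval_map]; exact isRoot_of_mem_roots ha⟩
  obtain ⟨y, hy⟩ := IsIntegrallyClosed.isIntegral_iff.mp this
  exact ⟨y, hy⟩

theorem isAlgClosed_residueField {R : Type*} [CommRing R] [IsLocalRing R]
    (hsplit : ∀ f : R[X], f.Monic → f.Splits) : IsAlgClosed (ResidueField R) := by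
  refine IsAlgClosed.of_exists_root _ fun p hp hirr => ?_
  obtain ⟨q, rfl, hdeg, hq⟩ := lifts_and_natDegree_eq_and_monic
    (map_surjective (residue R) residue_surjective p) hp
  exact ((hsplit q hq).map _).exists_eval_eq_zero hirr.degree_pos.ne'

/-- Integrality of F over ℤ makes ker f maximal and F algebraic over A / ker f. A valuation ring
dominating A at ker f has algebraically closed residue field, so F embeds in it over A / ker f. -/
theorem exists_valuationSubring_of_ringHom {K F : Type*} [Field K] [IsAlgClosed K] [Field F]
    [Algebra.IsIntegral ℤ F] (A : Subring K) (f : A →+* F) :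
    ∃ (R : ValuationSubring K) (j : F →+* ResidueField R) (hle : A ≤ R.toSubring),
      ∀ a : A, j (f a) = residue R ⟨a, hle a.2⟩ := by
  let := f.toAlgebra
  have : Algebra.IsIntegral A F := Algebra.IsIntegral.tower_top (R := ℤ)
  have hmax : (RingHom.ker f).IsMaximal :=
    Ideal.isMaximal_comap_of_isIntegral_of_isMaximal (R := A) (⊥ : Ideal F)
  obtain ⟨R, hle, hR⟩ := Ideal.image_subset_nonunits_valuationSubring (RingHom.ker f) hmax.ne_top
  have := isAlgClosed_residueField (valuationSubring_splits R)
  let φ : A →+* ResidueField R := (residue R).comp (Subring.inclusion hle)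
  have hφ : ∀ a ∈ RingHom.ker f, φ a = 0 := by
    intro a ha
    have : (a : K) ∈ R.nonunits := hR ⟨a, ha, rfl⟩
    rw [ValuationSubring.mem_nonunits_iff_exists_mem_maximalIdeal] at this
    obtain ⟨_, h⟩ := this
    exact (residue_eq_zero_iff _).mpr h
  let : Field (A ⧸ RingHom.ker f) := Ideal.Quotient.field _
  let : Algebra (A ⧸ RingHom.ker f) F := (RingHom.kerLift f).toAlgebra
  let : Algebra (A ⧸ RingHom.ker f) (ResidueField R) := (Ideal.Quotient.lift _ φ hφ).toAlgebra
  have : Algebra.IsIntegral (A ⧸ RingHom.ker f) F := Algebra.IsIntegral.tower_top (R := ℤ)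
  let j : F →ₐ[A ⧸ RingHom.ker f] ResidueField R := IsAlgClosed.lift
  exact ⟨R, j, hle, fun a => j.commutes (Ideal.Quotient.mk _ a)⟩

/-- The minimal polynomial of ζ over ℤ is cyclotomic and kills l, so ζ ↦ l defines a ring
homomorphism from ℤ[ζ]. -/
theorem exists_valuationSubring_of_isPrimitiveRoot {K F : Type*} [Field K] [CharZero K]
    [IsAlgClosed K] [Field F] [Algebra.IsIntegral ℤ F] {N : ℕ} [NeZero N] {l : F} {ζ : K}
    (hl : IsPrimitiveRoot l N) (hζ : IsPrimitiveRoot ζ N) :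
    ∃ (R : ValuationSubring K) (j : F →+* ResidueField R) (z : R),
      (z : K) = ζ ∧ residue R z = j l := by
  have hint : IsIntegral ℤ ζ := hζ.isIntegral (NeZero.pos N)
  let pb := Algebra.adjoin.powerBasis' hint
  let f : Algebra.adjoin ℤ {ζ} →ₐ[ℤ] F := pb.lift l (by
    rw [← Algebra.adjoin.powerBasis'_minpoly_gen hint, ← cyclotomic_eq_minpoly hζ (NeZero.pos N),
      aeval_def, eval₂_eq_eval_map, map_cyclotomic]
    exact hl.isRoot_cyclotomic (NeZero.pos N))
  obtain ⟨R, j, hle, h⟩ := exists_valuationSubring_of_ringHom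
    (Algebra.adjoin ℤ {ζ}).toSubring f.toRingHom
  refine ⟨R, j, ⟨ζ, hle (Algebra.self_mem_adjoin_singleton ℤ ζ)⟩, rfl, ?_⟩
  have h1 := h ⟨ζ, Algebra.self_mem_adjoin_singleton ℤ ζ⟩
  rw [← h1]
  congr 1
  have hgen : (⟨ζ, Algebra.self_mem_adjoin_singleton ℤ ζ⟩ : Algebra.adjoin ℤ {ζ}) = pb.gen :=
    (Algebra.adjoin.powerBasis'_gen hint).symm
  exact (congrArg f hgen).trans (pb.lift_gen l _)

end ValuationRing

end CoprimeLinear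

namespace CoprimeLinear

open Polynomial Module

/-! ### Traces of complex operators of finite order -/

section FiniteOrder

/-- Each entry 1 contributes 1, every other entry at least -1. -/
theorem re_sum_ge (M : Multiset ℂ) (hM : ∀ z ∈ M, ‖z‖ = 1) :
    2 * (M.count 1 : ℝ) - M.card ≤ M.sum.re := by
  induction M using Multiset.induction_on with
  | empty => simp
  | cons z M ih =>
    have h1 := ih fun x hx => hM x (Multiset.mem_cons_of_mem hx)
    have h2 := (abs_le.mp ((Complex.abs_re_le_norm z).trans
      (hM z (Multiset.mem_cons_self z M)).le)).1
    rw [Multiset.sum_cons, Multiset.card_cons, Multiset.count_cons, Complex.add_re]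
    by_cases hz : 1 = z
    · subst hz; simp; linarith
    · simp [hz]; linarith

theorem norm_sum_le_card (M : Multiset ℂ) (hM : ∀ z ∈ M, ‖z‖ = 1) : ‖M.sum‖ ≤ M.card := by
  induction M using Multiset.induction_on with
  | empty => simp
  | cons z M ih =>
    rw [Multiset.sum_cons, Multiset.card_cons]
    have h1 := ih fun x hx => hM x (Multiset.mem_cons_of_mem hx)
    have h2 := norm_add_le z M.sum
    rw [hM z (Multiset.mem_cons_self z M)] at h2
    push_cast
    linarith

theorem sum_eq_card_mul_of_norm_sum_eq (M : Multiset ℂ) (hM : ∀ z ∈ M, ‖z‖ = 1)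
    (h : ‖M.sum‖ = M.card) {z : ℂ} (hz : z ∈ M) : M.sum = M.card * z := by
  obtain ⟨M, rfl⟩ := Multiset.exists_cons_of_mem hz
  rw [Multiset.sum_cons, Multiset.card_cons] at h
  have h1 := norm_sum_le_card M fun x hx => hM x (Multiset.mem_cons_of_mem hx)
  have h2 := norm_add_le z M.sum
  have h3 := hM z hz
  push_cast at h
  have h4 : ‖M.sum‖ = M.card := by linarith
  have h5 : SameRay ℝ z M.sum := sameRay_iff_norm_add.mpr (by linarith)
  have h6 := h5.norm_smul_eq
  rw [h3, h4, one_smul] at h6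
  rw [Multiset.sum_cons, Multiset.card_cons, h6, Complex.real_smul]
  push_cast
  ring

variable {W : Type*} [AddCommGroup W] [Module ℂ W] [FiniteDimensional ℂ W] {f : End ℂ W} {N : ℕ}

theorem pow_eq_one_of_mem_roots_charpoly (hf : f ^ N = 1) {z : ℂ} (hz : z ∈ f.charpoly.roots) :
    z ^ N = 1 := by
  obtain ⟨v, hv⟩ := ((End.hasEigenvalue_iff_isRoot_charpoly f z).mpr
    (isRoot_of_mem_roots hz)).exists_hasEigenvector
  have h := hv.pow_apply N
  rw [hf, End.one_apply] at h
  exact (smul_left_injective ℂ hv.2 (by simpa using h)).symm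

theorem norm_eq_one_of_mem_roots_charpoly (hN : N ≠ 0) (hf : f ^ N = 1) {z : ℂ}
    (hz : z ∈ f.charpoly.roots) : ‖z‖ = 1 :=
  Complex.norm_eq_one_of_pow_eq_one (pow_eq_one_of_mem_roots_charpoly hf hz) hN

theorem finrank_eigenspace_eq_count (hN : N ≠ 0) (hf : f ^ N = 1) (z : ℂ) :
    finrank ℂ (f.eigenspace z) = f.charpoly.roots.count z := by
  have hss : f.IsSemisimple := by
    refine End.isSemisimple_of_squarefree_aeval_eq_zero (p := X ^ N - 1) ?_ (by simp [hf])
    exact (separable_X_pow_sub_C (1 : ℂ) (by exact_mod_cast hN) one_ne_zero).squarefree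
  rw [← hss.isFinitelySemisimple.maxGenEigenspace_eq_eigenspace, count_roots,
    LinearMap.finrank_maxGenEigenspace_eq]

theorem card_roots_charpoly : f.charpoly.roots.card = finrank ℂ W := by
  rw [← (IsAlgClosed.splits f.charpoly).natDegree_eq_card_roots, LinearMap.charpoly_natDegree]

theorem trace_eq_sum_roots : LinearMap.trace ℂ W f = f.charpoly.roots.sum :=
  End.trace_eq_sum_roots_charpoly_of_splits (IsAlgClosed.splits _)

theorem norm_trace_le (hN : N ≠ 0) (hf : f ^ N = 1) :
    ‖LinearMap.trace ℂ W f‖ ≤ finrank ℂ W := by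
  rw [trace_eq_sum_roots, ← card_roots_charpoly (f := f)]
  exact norm_sum_le_card _ fun _ => norm_eq_one_of_mem_roots_charpoly hN hf

theorem norm_trace_ge (hN : N ≠ 0) (hf : f ^ N = 1) :
    2 * (finrank ℂ (f.eigenspace 1) : ℝ) - finrank ℂ W ≤ ‖LinearMap.trace ℂ W f‖ := by
  rw [trace_eq_sum_roots, ← card_roots_charpoly (f := f), finrank_eigenspace_eq_count hN hf]
  exact (re_sum_ge _ fun _ => norm_eq_one_of_mem_roots_charpoly hN hf).trans (Complex.re_le_norm _)

theorem exists_eq_smul_one_of_norm_trace_eq (hN : N ≠ 0) (hf : f ^ N = 1)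
    (h : ‖LinearMap.trace ℂ W f‖ = finrank ℂ W) : ∃ c : ℂ, f = c • 1 := by
  rcases Nat.eq_zero_or_pos (finrank ℂ W) with h0 | hpos
  · have := finrank_zero_iff.mp h0
    exact ⟨1, Subsingleton.elim _ _⟩
  have hroots := fun z => norm_eq_one_of_mem_roots_charpoly (z := z) hN hf
  rw [trace_eq_sum_roots, ← card_roots_charpoly (f := f)] at h
  rw [← card_roots_charpoly (f := f)] at hpos
  obtain ⟨c, hc⟩ := Multiset.card_pos_iff_exists_mem.mp hpos
  have hcne : (f.charpoly.roots.card : ℂ) ≠ 0 := by exact_mod_cast hpos.ne'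
  have hall : ∀ z ∈ f.charpoly.roots, z = c := fun z hz =>
    mul_left_cancel₀ hcne ((sum_eq_card_mul_of_norm_sum_eq _ hroots h hz).symm.trans
      (sum_eq_card_mul_of_norm_sum_eq _ hroots h hc))
  have htop : f.eigenspace c = ⊤ := by
    apply Submodule.eq_top_of_finrank_eq
    rw [finrank_eigenspace_eq_count hN hf, Multiset.eq_replicate_card.mpr hall,
      Multiset.count_replicate_self, card_roots_charpoly]
  refine ⟨c, LinearMap.ext fun w => ?_⟩
  have : w ∈ f.eigenspace c := htop ▸ Submodule.mem_top
  simpa using End.mem_eigenspace_iff.mp this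

/-- The fixed space of f is the preimage of that of F, so its codimension in W is at most s; then
`norm_trace_ge` applies. -/
theorem norm_trace_ge_of_injective {U : Type*} [AddCommGroup U] [Module ℂ U]
    [FiniteDimensional ℂ U] {F : End ℂ U} {φ : W →ₗ[ℂ] U} (hφ : Function.Injective φ)
    (hcomm : ∀ w, φ (f w) = F (φ w)) (hN : N ≠ 0) (hf : f ^ N = 1) {s : ℕ}
    (hs : finrank ℂ U ≤ finrank ℂ (F.eigenspace 1) + s) :
    (finrank ℂ W : ℝ) - 2 * s ≤ ‖LinearMap.trace ℂ W f‖ := by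
  have hE : f.eigenspace 1 = (F.eigenspace 1).comap φ := by
    ext w
    rw [Submodule.mem_comap, End.mem_eigenspace_iff, End.mem_eigenspace_iff, ← hcomm, one_smul,
      one_smul, hφ.eq_iff]
  have h1 := Submodule.finrank_sup_add_finrank_inf_eq (LinearMap.range φ) (F.eigenspace 1)
  have h2 := Submodule.finrank_le (LinearMap.range φ ⊔ F.eigenspace 1)
  rw [← Submodule.map_comap_eq, ← hE,
    ← (Submodule.equivMapOfInjective φ hφ (f.eigenspace 1)).finrank_eq,
    LinearMap.finrank_range_of_inj hφ] at h1
  have h3 : finrank ℂ W ≤ finrank ℂ (f.eigenspace 1) + s := by omega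
  have h4 := norm_trace_ge hN hf
  have h5 : (finrank ℂ W : ℝ) ≤ finrank ℂ (f.eigenspace 1) + s := by exact_mod_cast h3
  linarith

end FiniteOrder

/-! ### Complex characters: inverses and decomposition into irreducibles -/

section Characters

open scoped ComplexOrder

variable {G : Type*} [Group G]

/-- The averaged Hermitian form `H` is invariant and invertible, and conjugates ρ(g⁻¹) into the
adjoint of ρ(g). -/
theorem trace_inv_eq_star_trace [Fintype G] {ι : Type*} [Fintype ι] [DecidableEq ι]
    (ρ : G →* Matrix ι ι ℂ) (g : G) : (ρ g⁻¹).trace = star (ρ g).trace := by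
  set H : Matrix ι ι ℂ := ∑ x, (ρ x).conjTranspose * ρ x
  have hH : IsUnit H := by
    classical
    have : H = 1 + ∑ x ∈ Finset.univ.erase 1, (ρ x).conjTranspose * ρ x := by
      simp only [H]; rw [← Finset.add_sum_erase _ _ (Finset.mem_univ (1 : G))]; simp
    rw [this]
    exact (Matrix.PosDef.one.add_posSemidef (Matrix.posSemidef_sum _ fun x _ =>
      Matrix.posSemidef_conjTranspose_mul_self _)).isUnit
  have hinv : H * ρ g⁻¹ = (ρ g).conjTranspose * H := by
    rw [Finset.sum_mul, Finset.mul_sum]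
    refine Fintype.sum_equiv (Equiv.mulRight g⁻¹) _ _ fun x => ?_
    have h1 : ρ x = ρ (x * g⁻¹) * ρ g := by rw [← map_mul, inv_mul_cancel_right]
    rw [Equiv.coe_mulRight, Matrix.mul_assoc, ← map_mul ρ x, h1, Matrix.conjTranspose_mul,
      Matrix.mul_assoc]
  obtain ⟨B, hB⟩ := hH.exists_right_inv
  have : ρ g⁻¹ = B * ((ρ g).conjTranspose * H) := by
    rw [← hinv, ← Matrix.mul_assoc, (mul_eq_one_comm.mp hB : B * H = 1), Matrix.one_mul]
  rw [this, Matrix.trace_mul_comm, Matrix.mul_assoc, hB, Matrix.mul_one,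
    Matrix.trace_conjTranspose]

theorem trace_eq_add_of_isCompl {U : Type*} [AddCommGroup U] [Module ℂ U]
    [FiniteDimensional ℂ U] (f : End ℂ U) {p q : Submodule ℂ U} (h : IsCompl p q)
    (hp : ∀ v ∈ p, f v ∈ p) (hq : ∀ v ∈ q, f v ∈ q) :
    LinearMap.trace ℂ U f =
      LinearMap.trace ℂ p (f.restrict hp) + LinearMap.trace ℂ q (f.restrict hq) := by
  rw [← LinearMap.trace_prodMap', ← LinearMap.trace_conj' _ (Submodule.prodEquivOfIsCompl p q h)]
  congr 1
  refine LinearMap.ext fun v => ?_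
  obtain ⟨w, rfl⟩ := (Submodule.prodEquivOfIsCompl p q h).surjective v
  simp [LinearEquiv.conj_apply]

/-- Maschke and induction on dimension: the bound is additive over complementary subrepresentations.
-/
theorem norm_character_le_of_irreducible [Finite G] {d : ℕ} (ρ : Representation ℂ G (Fin d → ℂ))
    (g : G) (c : ℝ)
    (h : ∀ (m : ℕ) (σ : Representation ℂ G (Fin m → ℂ)) (φ : (Fin m → ℂ) →ₗ[ℂ] (Fin d → ℂ)),
      σ.IsIrreducible → Function.Injective φ → (∀ x w, φ (σ x w) = ρ x (φ w)) →
      ‖σ.character g‖ ≤ c * m) :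
    ‖ρ.character g‖ ≤ c * d := by
  induction d using Nat.strong_induction_on with
  | _ d ih =>
    rcases Nat.eq_zero_or_pos d with rfl | hd
    · have : ρ g = 0 := Subsingleton.elim _ _
      simp [Representation.character, this]
    by_cases hirr : ρ.IsIrreducible
    · exact h d ρ LinearMap.id hirr Function.injective_id fun _ _ => rfl
    have : NeZero d := ⟨hd.ne'⟩
    have hnt : Nontrivial (Subrepresentation ρ) := ⟨⊥, ⊤, fun hbt => by
      have : (⊥ : Submodule ℂ (Fin d → ℂ)) = ⊤ := congrArg Subrepresentation.toSubmodule hbt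
      exact bot_ne_top this⟩
    obtain ⟨W, hWb, hWt⟩ : ∃ W : Subrepresentation ρ, W ≠ ⊥ ∧ W ≠ ⊤ := by
      by_contra! hcon
      exact hirr ⟨fun W => or_iff_not_imp_left.mpr (hcon W)⟩
    have hNe : NeZero (Nat.card G : ℂ) := ⟨by exact_mod_cast Nat.card_pos.ne'⟩
    obtain ⟨W', hW'⟩ := exists_isCompl W
    have hcompl : IsCompl W.toSubmodule W'.toSubmodule :=
      IsCompl.of_eq (congrArg Subrepresentation.toSubmodule hW'.inf_eq_bot)
        (congrArg Subrepresentation.toSubmodule hW'.sup_eq_top)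
    have hsum := Submodule.finrank_add_eq_of_isCompl hcompl
    rw [finrank_fin_fun] at hsum
    have hpos : ∀ Y : Subrepresentation ρ, Y ≠ ⊥ → 0 < finrank ℂ Y.toSubmodule := by
      intro Y hY
      rw [Nat.pos_iff_ne_zero, Ne, Submodule.finrank_eq_zero]
      exact fun h0 => hY (Subrepresentation.toSubmodule_injective h0)
    have hW'b : W' ≠ ⊥ := by
      rintro rfl
      exact hWt (by simpa using hW'.sup_eq_top)
    have step : ∀ Y : Subrepresentation ρ, finrank ℂ Y.toSubmodule < d →
        ‖Y.toRepresentation.character g‖ ≤ c * finrank ℂ Y.toSubmodule := by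
      intro Y hY
      let e : Y.toSubmodule ≃ₗ[ℂ] (Fin (finrank ℂ Y.toSubmodule) → ℂ) :=
        (finBasis ℂ Y.toSubmodule).equivFun
      let τ : Representation ℂ G (Fin (finrank ℂ Y.toSubmodule) → ℂ) :=
        (e.conjRingEquiv : End ℂ Y.toSubmodule →* _).comp Y.toRepresentation
      have hτ : τ.character g = Y.toRepresentation.character g :=
        LinearMap.trace_conj' (Y.toRepresentation g) e
      rw [← hτ]
      refine ih _ hY τ fun m σ φ hσ hφ hc => h m σ
        (Y.toSubmodule.subtype ∘ₗ e.symm.toLinearMap ∘ₗ φ) hσ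
        (Subtype.val_injective.comp (e.symm.injective.comp hφ)) fun x w => ?_
      have h1 : e.symm (φ (σ x w)) = Y.toRepresentation x (e.symm (φ w)) := by
        rw [hc, LinearEquiv.symm_apply_eq]; rfl
      exact congrArg Subtype.val h1
    have h1 := step W (by have := hpos _ hW'b; omega)
    have h2 := step W' (by have := hpos _ hWb; omega)
    have h3 : ρ.character g = W.toRepresentation.character g + W'.toRepresentation.character g :=
      trace_eq_add_of_isCompl (ρ g) hcompl (W.apply_mem_toSubmodule g) (W'.apply_mem_toSubmodule g)
    have hsum' : (d : ℝ) = finrank ℂ W.toSubmodule + finrank ℂ W'.toSubmodule := by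
      exact_mod_cast hsum.symm
    rw [h3, hsum', mul_add]
    linarith [norm_add_le (W.toRepresentation.character g) (W'.toRepresentation.character g)]

end Characters

end CoprimeLinear

namespace CoprimeLinear

open Polynomial Module IsLocalRing

/-! ### The complex lift of a coprime representation -/

section Lift

variable {K V F : Type*} [Field K] [AddCommGroup V] [Module K V] [FiniteDimensional K V]
  [Field F] [IsAlgClosed F] [Algebra.IsIntegral ℤ F] [Algebra K F] {G : Type*} [Group G] [Fintype G]

/-- A representation `τ` of a finite group of order prime to the characteristic lifts to a complex
representation whose eigenvalues correspond to those of `τ` under a prescribed isomorphism of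
groups of roots of unity, and such that a subgroup without fixed vectors on `V` has no fixed
vectors on the lift. -/
theorem exists_complex_lift (τ : Representation K G V) (hcard : (Fintype.card G : K) ≠ 0)
    {l : F} {ζ : ℂ} (hl : IsPrimitiveRoot l (Fintype.card G))
    (hζ : IsPrimitiveRoot ζ (Fintype.card G)) :
    ∃ ρ : G →* Matrix (Fin (finrank K V)) (Fin (finrank K V)) ℂ,
      (∀ θ : F → ℂ, (∀ a : ℕ, θ (l ^ a) = ζ ^ a) → ∀ g,
        (ρ g).charpoly.roots = ((τ g).charpoly.map (algebraMap K F)).roots.map θ) ∧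
      (∀ H : Subgroup G, (∀ v, (∀ h ∈ H, τ h v = v) → v = 0) →
        ∀ w, (∀ h ∈ H, (ρ h).mulVec w = w) → w = 0) := by
  classical
  have : NeZero (Fintype.card G) := ⟨Fintype.card_ne_zero⟩
  obtain ⟨R, j, z, hz, hzl⟩ := exists_valuationSubring_of_isPrimitiveRoot hl hζ
  let b := finBasis K V
  let i : K →+* ResidueField R := j.comp (algebraMap K F)
  let T : G →* Matrix (Fin (finrank K V)) (Fin (finrank K V)) (ResidueField R) :=
    i.mapMatrix.toMonoidHom.comp ((MonoidHomClass.toMonoidHom (LinearMap.toMatrixAlgEquiv b)).comp τ)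
  have hT : ∀ g, T g = (LinearMap.toMatrix b b (τ g)).map i := fun _ => rfl
  obtain ⟨ρ, hρ⟩ := exists_representation_lift (valuationSubring_splits R) T (by
    rw [← map_natCast i]; exact (map_ne_zero i).mpr hcard)
  let ρ' : G →* Matrix (Fin (finrank K V)) (Fin (finrank K V)) ℂ :=
    (algebraMap R ℂ).mapMatrix.toMonoidHom.comp ρ
  have hρ' : ∀ g, ρ' g = (ρ g).map (algebraMap R ℂ) := fun _ => rfl
  have hinj : Function.Injective (algebraMap R ℂ) := Subtype.val_injective
  refine ⟨ρ', fun θ hθ g => ?_, fun H hH w hw => ?_⟩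
  · have hsp := valuationSubring_splits R _ (ρ g).charpoly_monic
    have h1 : (ρ' g).charpoly.roots = (ρ g).charpoly.roots.map (algebraMap R ℂ) := by
      rw [hρ', Matrix.charpoly_map, hsp.roots_map_of_injective hinj]
    have h2 : (ρ g).charpoly.roots.map (residue R) =
        ((τ g).charpoly.map (algebraMap K F)).roots.map j := by
      rw [← hsp.roots_map_of_ne_zero ((ρ g).charpoly_monic.map _).ne_zero,
        ← (IsAlgClosed.splits _).roots_map_of_injective j.injective, ← Matrix.charpoly_map, hρ, hT,
        Matrix.charpoly_map, LinearMap.charpoly_toMatrix, Polynomial.map_map]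
    -- A root of the lifted characteristic polynomial is a power of ζ, so its residue, a power of `j
    -- l`, determines it.
    have h3 : ∀ r ∈ (ρ g).charpoly.roots,
        algebraMap R ℂ r = θ (Function.invFun j (residue R r)) := by
      intro r hr
      have hr1 : r ^ Fintype.card G = 1 := by
        apply hinj
        rw [map_pow, map_one]
        apply pow_eq_one_of_mem_roots_charpoly (f := Matrix.toLin' (ρ' g))
        · rw [← Matrix.toLin'_pow, ← map_pow, pow_card_eq_one, map_one, Matrix.toLin'_one]; rfl
        · rw [Matrix.charpoly_toLin', h1]
          exact Multiset.mem_map_of_mem _ hr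
      have hz1 : algebraMap R ℂ z = ζ := hz
      obtain ⟨a, -, ha⟩ := hζ.eq_pow_of_pow_eq_one (ξ := algebraMap R ℂ r) (by
        rw [← map_pow, hr1, map_one])
      have hra : r = z ^ a := hinj (by rw [← ha, map_pow, hz1])
      rw [hra, map_pow, map_pow, hz1, hzl, ← map_pow, Function.leftInverse_invFun j.injective, hθ]
    have h4 := congrArg (Multiset.map fun y => θ (Function.invFun j y)) h2
    rw [Multiset.map_map, Multiset.map_map] at h4
    rw [h1, Multiset.map_congr rfl h3]
    refine h4.trans (Multiset.map_congr rfl fun x _ => ?_)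
    rw [Function.comp_apply, Function.leftInverse_invFun j.injective]
  · have hτ : ∑ h : H, τ h = 0 := by
      ext v
      refine hH _ fun h hh => ?_
      rw [LinearMap.sum_apply, map_sum]
      refine Fintype.sum_equiv (Equiv.mulLeft (⟨h, hh⟩ : H)) _ _ fun x => ?_
      simp [map_mul]
    have hT0 : ∑ h : H, T h = 0 := by
      have : ∑ h : H, T h = (LinearMap.toMatrix b b (∑ h : H, τ h)).map i := by
        simp only [hT, map_sum]
        exact (map_sum i.mapMatrix _ _).symm
      rw [this, hτ, map_zero, Matrix.map_zero _ (map_zero i)]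
    -- The sum over H is 0 on V, so this matrix reduces to the scalar |H| ≠ 0. Over ℂ it kills every
    -- H-fixed vector, which must then vanish.
    have hunit : IsUnit ((Fintype.card H : Matrix (Fin (finrank K V)) (Fin (finrank K V)) R) -
        ∑ h : H, ρ h) := by
      apply isUnit_of_isUnit_map_residue
      have : ((Fintype.card H : Matrix (Fin (finrank K V)) (Fin (finrank K V)) R) -
          ∑ h : H, ρ h).map (residue R) = algebraMap (ResidueField R) _ (Fintype.card H) := by
        change (residue R).mapMatrix _ = _
        rw [map_sub, map_sum, map_natCast, map_natCast]
        simp only [RingHom.mapMatrix_apply, hρ, hT0, sub_zero]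
      rw [this]
      refine IsUnit.map _ (IsUnit.mk0 _ ?_)
      rw [← map_natCast i]
      refine (map_ne_zero i).mpr fun h0 => hcard ?_
      obtain ⟨m, hm⟩ := Subgroup.card_subgroup_dvd_card H
      rw [Nat.card_eq_fintype_card, Nat.card_eq_fintype_card] at hm
      rw [hm, Nat.cast_mul, h0, zero_mul]
    have hunit' := hunit.map (algebraMap R ℂ).mapMatrix
    rw [map_sub, map_sum, map_natCast] at hunit'
    apply Matrix.mulVec_injective_of_isUnit hunit'
    have hw' : ∀ h : H, ((algebraMap R ℂ).mapMatrix (ρ h)).mulVec w = w := fun h => hw h h.2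
    rw [Matrix.mulVec_zero, Matrix.sub_mulVec, Matrix.sum_mulVec]
    simp only [hw']
    ext x
    simp

end Lift

end CoprimeLinear

namespace CoprimeLinear

open Polynomial Module

/-! ### Normal subgroups and central elements of an irreducible linear group -/

section IrreducibleLinearGroup

variable {K V : Type*} [Field K] [AddCommGroup V] [Module K V]
  {G : Subgroup (LinearMap.GeneralLinearGroup K V)}

theorem natRep_eq_one {g : G} (h : natRep G g = 1) : g = 1 :=
  Subtype.ext (Units.ext h)

/-- The fixed vectors of a normal subgroup form a subrepresentation, which is everything as soon as
it is nonzero. -/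
theorem eq_one_of_mem_normal_of_fixed (hirr : (natRep G).IsIrreducible) {H : Subgroup G} [H.Normal]
    {v : V} (hv : v ≠ 0) (hfix : ∀ h ∈ H, natRep G h v = v) {g : G} (hg : g ∈ H) : g = 1 := by
  let Y : Subrepresentation (natRep G) :=
    { toSubmodule := ⨅ h : H, LinearMap.eqLocus (natRep G h) LinearMap.id
      apply_mem_toSubmodule := by
        intro x u hu
        simp only [Submodule.mem_iInf, LinearMap.mem_eqLocus, LinearMap.id_apply] at hu ⊢
        intro h
        have h1 := hu ⟨x⁻¹ * h * x⁻¹⁻¹, Subgroup.Normal.conj_mem inferInstance _ h.2 _⟩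
        have h2 := congrArg (natRep G x) h1
        rw [← Module.End.mul_apply, ← map_mul] at h2
        simpa [mul_assoc] using h2 }
  have hvY : v ∈ Y.toSubmodule := by
    simp only [Y, Submodule.mem_iInf, LinearMap.mem_eqLocus, LinearMap.id_apply]
    exact fun h => hfix h h.2
  have hY : Y = ⊤ := (hirr.eq_bot_or_eq_top Y).resolve_left fun h => hv (by
    rw [h] at hvY; exact (Submodule.mem_bot K).mp hvY)
  apply natRep_eq_one
  ext u
  have hu : u ∈ Y.toSubmodule := by rw [hY]; exact Submodule.mem_top
  simp only [Y, Submodule.mem_iInf, LinearMap.mem_eqLocus, LinearMap.id_apply] at hu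
  exact hu ⟨g, hg⟩

theorem supp_eq_finrank_of_central (hirr : (natRep G).IsIrreducible) {g : G} (hg : g ≠ 1)
    (hcentral : ∀ x : G, x * g = g * x) : supp (g : LinearMap.GeneralLinearGroup K V) =
      finrank K V := by
  have hbot : fixSpace (g : LinearMap.GeneralLinearGroup K V) = ⊥ := by
    rw [Submodule.eq_bot_iff]
    intro v hv
    by_contra hv0
    have : (Subgroup.zpowers g).Normal := ⟨by
      intro h hh x
      obtain ⟨m, rfl⟩ := Subgroup.mem_zpowers_iff.mp hh
      have : Commute x (g ^ m) := Commute.zpow_right (hcentral x) m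
      rw [this.eq, mul_inv_cancel_right]
      exact hh⟩
    refine hg (eq_one_of_mem_normal_of_fixed hirr hv0 (H := Subgroup.zpowers g) ?_
      (Subgroup.mem_zpowers g))
    intro h hh
    have hle : Subgroup.zpowers g ≤
        (MulAction.stabilizer (LinearMap.GeneralLinearGroup K V) v).comap G.subtype :=
      (Subgroup.zpowers_le).mpr hv
    exact hle hh
  rw [supp, hbot, finrank_bot, Nat.sub_zero]

end IrreducibleLinearGroup

/-! ### Supports in V compared with characters of the lift -/

section Lift

variable {K V : Type*} [Field K] [AddCommGroup V] [Module K V] [FiniteDimensional K V]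
  {G : Subgroup (LinearMap.GeneralLinearGroup K V)} [Finite G]

/-- A complex representation of `G` that carries enough information on the natural
representation to bound supports. -/
structure IsFaithfulLift (G : Subgroup (LinearMap.GeneralLinearGroup K V))
    (U : Representation ℂ G (Fin (finrank K V) → ℂ)) : Prop where
  finrank_le : ∀ g : G, finrank K V ≤ finrank ℂ (End.eigenspace (U g) 1) +
    supp (g : LinearMap.GeneralLinearGroup K V)
  fixed_eq_zero : ∀ H : Subgroup G, (∀ v, (∀ h ∈ H, natRep G h v = v) → v = 0) →
    ∀ w, (∀ h ∈ H, U h w = w) → w = 0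

theorem isIntegral_int_of_finite (K F : Type*) [Field K] [Finite K] [Field F] [Algebra K F]
    [Algebra.IsIntegral K F] : Algebra.IsIntegral ℤ F :=
  have : Module.Finite ℤ K := Module.Finite.of_finite
  Algebra.IsIntegral.trans K

theorem pow_card_eq_one_rep {G : Type*} [Group G] {W : Type*} [AddCommGroup W] [Module ℂ W]
    (σ : Representation ℂ G W) (g : G) : (σ g) ^ Nat.card G = 1 := by
  rw [← map_pow, pow_card_eq_one', map_one]

theorem exists_faithfulLift [Finite K] (hcard : (Nat.card G : K) ≠ 0)
    {l : AlgebraicClosure K} {ζ : ℂ} (hl : IsPrimitiveRoot l (Nat.card G))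
    (hζ : IsPrimitiveRoot ζ (Nat.card G)) {θ : AlgebraicClosure K → ℂ}
    (hθ : ∀ a : ℕ, θ (l ^ a) = ζ ^ a) :
    ∃ U : Representation ℂ G (Fin (finrank K V) → ℂ), IsFaithfulLift G U ∧
      (∀ g, U.character g⁻¹ = star (U.character g)) ∧
      ∀ g, U.character g =
        (((natRep G g).charpoly.map (algebraMap K (AlgebraicClosure K))).roots.map θ).sum := by
  classical
  have := Fintype.ofFinite G
  have := isIntegral_int_of_finite K (AlgebraicClosure K)
  have hN : Nat.card G ≠ 0 := Nat.card_pos.ne'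
  rw [Nat.card_eq_fintype_card] at hl hζ hcard
  obtain ⟨ρ, hroots, hfix⟩ := exists_complex_lift (natRep G) hcard hl hζ
  let U : Representation ℂ G (Fin (finrank K V) → ℂ) :=
    (MonoidHomClass.toMonoidHom (Matrix.toLinAlgEquiv' (R := ℂ))).comp ρ
  have hU : ∀ g, U g = Matrix.toLin' (ρ g) := fun _ => rfl
  have hUroots : ∀ g, (U g).charpoly.roots =
      ((natRep G g).charpoly.map (algebraMap K (AlgebraicClosure K))).roots.map θ := fun g => by
    rw [hU, Matrix.charpoly_toLin', hroots θ hθ]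
  have htr : ∀ g, U.character g = (ρ g).trace := fun g => by
    rw [Representation.character, hU, Matrix.trace_toLin'_eq]
  refine ⟨U, ⟨fun g => ?_, fun H hH w hw => hfix H hH w fun h hh => ?_⟩, fun g => ?_, fun g => ?_⟩
  · rw [finrank_eigenspace_eq_count hN (pow_card_eq_one_rep U g), hUroots]
    have h1 : finrank K (fixSpace (g : LinearMap.GeneralLinearGroup K V)) ≤
        (natRep G g).charpoly.rootMultiplicity 1 := by
      have : fixSpace (g : LinearMap.GeneralLinearGroup K V) = End.eigenspace (natRep G g) 1 := by
        ext v
        rw [End.mem_eigenspace_iff, one_smul]; rfl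
      rw [this]
      exact LinearMap.finrank_eigenspace_le _ _
    have hne : (natRep G g).charpoly.map (algebraMap K (AlgebraicClosure K)) ≠ 0 :=
      ((natRep G g).charpoly_monic.map _).ne_zero
    have h2 := le_rootMultiplicity_map hne 1
    rw [map_one, ← count_roots, ← count_roots] at h2
    rw [← count_roots] at h1
    -- Only an inequality is needed: θ carries each eigenvalue 1 to 1.
    have h3 := Multiset.map_le_map (f := θ) (Multiset.le_count_iff_replicate_le.mp
      (le_refl (((natRep G g).charpoly.map (algebraMap K (AlgebraicClosure K))).roots.count 1)))
    have h4 : θ 1 = 1 := by simpa using hθ 0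
    rw [Multiset.map_replicate, h4, ← Multiset.le_count_iff_replicate_le] at h3
    have h5 : finrank K V = finrank K (fixSpace (g : LinearMap.GeneralLinearGroup K V)) +
        supp (g : LinearMap.GeneralLinearGroup K V) := by
      have := Submodule.finrank_le (fixSpace (g : LinearMap.GeneralLinearGroup K V))
      rw [supp]; omega
    omega
  · have := hw h hh
    rwa [hU, Matrix.toLin'_apply] at this
  · rw [htr, htr, trace_inv_eq_star_trace]
  · rw [Representation.character, trace_eq_sum_roots, hUroots]

variable {W : Type*} [AddCommGroup W] [Module ℂ W] [FiniteDimensional ℂ W]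
  {U : Representation ℂ G (Fin (finrank K V) → ℂ)} {σ : Representation ℂ G W}
  {φ : W →ₗ[ℂ] (Fin (finrank K V) → ℂ)}

omit [FiniteDimensional K V] [Finite G] [FiniteDimensional ℂ W] in
-- The kernel of σ fixes a nonzero vector of U, hence one of V; being normal, it is trivial.
theorem IsFaithfulLift.eq_one (hU : IsFaithfulLift G U) (hirr : (natRep G).IsIrreducible)
    [Nontrivial W] (hφ : Function.Injective φ) (hcomm : ∀ x w, φ (σ x w) = U x (φ w)) {g : G}
    (hg : σ g = 1) : g = 1 := by
  obtain ⟨w, hw⟩ := exists_ne (0 : W)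
  by_contra hne
  refine hw (hφ ((hU.fixed_eq_zero (MonoidHom.ker σ) (fun v hv => ?_) (φ w) fun h hh => ?_).trans
    (map_zero φ).symm))
  · by_contra hv0
    exact hne (eq_one_of_mem_normal_of_fixed hirr hv0 hv (MonoidHom.mem_ker.mpr hg))
  · rw [← hcomm, MonoidHom.mem_ker.mp hh, End.one_apply]

omit [FiniteDimensional K V] in
theorem IsFaithfulLift.supp_eq_finrank (hU : IsFaithfulLift G U)
    (hirr : (natRep G).IsIrreducible) [Nontrivial W] (hφ : Function.Injective φ)
    (hcomm : ∀ x w, φ (σ x w) = U x (φ w)) {g : G} (hg : g ≠ 1)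
    (hnorm : ‖σ.character g‖ = finrank ℂ W) :
    supp (g : LinearMap.GeneralLinearGroup K V) = finrank K V := by
  obtain ⟨c, hc⟩ := exists_eq_smul_one_of_norm_trace_eq Nat.card_pos.ne'
    (pow_card_eq_one_rep σ g) hnorm
  refine supp_eq_finrank_of_central hirr hg fun x => ?_
  rw [← mul_inv_eq_one]
  refine hU.eq_one hirr hφ hcomm ?_
  have h : σ (x * g) = σ (g * x) := by simp [hc]
  rw [map_mul, h, ← map_mul, mul_inv_cancel, map_one]

omit [FiniteDimensional K V] in
theorem IsFaithfulLift.norm_character_ge (hU : IsFaithfulLift G U) (hφ : Function.Injective φ)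
    (hcomm : ∀ x w, φ (σ x w) = U x (φ w)) (g : G) :
    (finrank ℂ W : ℝ) - 2 * supp (g : LinearMap.GeneralLinearGroup K V) ≤ ‖σ.character g‖ :=
  norm_trace_ge_of_injective hφ (hcomm g) Nat.card_pos.ne' (pow_card_eq_one_rep σ g)
    (by rw [finrank_fin_fun]; exact hU.finrank_le g)

end Lift

/-! ### Character ratios and constituents -/

section CharacterRatios

variable {G : Type*} [Group G] [Finite G] {m : ℕ} (σ : Representation ℂ G (Fin m → ℂ))

theorem norm_character_le (g : G) : ‖σ.character g‖ ≤ m := by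
  have := norm_trace_le (f := σ g) Nat.card_pos.ne' (by
    rw [← map_pow, pow_card_eq_one' (G := G), map_one])
  rwa [finrank_fin_fun] at this

omit [Finite G] in
theorem character_one_eq : σ.character 1 = m := by
  rw [Representation.char_one, finrank_fin_fun]

omit [Finite G] in
theorem mem_charCenter_iff (g : G) : g ∈ charCenter σ.character ↔ ‖σ.character g‖ = m := by
  rw [charCenter, Set.mem_ofPred_eq, character_one_eq]
  norm_cast

omit [Finite G] in
theorem maxOffCenter_nonneg (χ : G → ℂ) : 0 ≤ maxOffCenter χ :=
  Real.sSup_nonneg (by rintro _ ⟨g, -, rfl⟩; exact norm_nonneg _)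

theorem norm_le_maxOffCenter {χ : G → ℂ} {g : G} (hg : g ∉ charCenter χ) :
    ‖χ g‖ ≤ maxOffCenter χ := by
  refine le_csSup ((Set.finite_range fun g => ‖χ g‖).subset ?_).bddAbove ⟨g, hg, rfl⟩
  rintro _ ⟨g, -, rfl⟩
  exact ⟨g, rfl⟩

omit [Finite G] in
theorem mrChar_nonneg : 0 ≤ mrChar σ.character :=
  Real.sSup_nonneg (by
    rintro _ ⟨g, -, rfl⟩
    rw [character_one_eq]
    exact div_nonneg (norm_nonneg _) (by simp))

theorem mrChar_le_one : mrChar σ.character ≤ 1 :=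
  Real.sSup_le (by
    rintro _ ⟨g, -, rfl⟩
    rw [character_one_eq]
    exact div_le_one_of_le₀ (by simpa using norm_character_le σ g) (by simp)) zero_le_one

theorem norm_le_mrChar_mul {g : G} (hg : g ∉ charCenter σ.character) :
    ‖σ.character g‖ ≤ mrChar σ.character * m := by
  rcases Nat.eq_zero_or_pos m with rfl | hm
  · simpa using norm_character_le σ g
  have : ‖σ.character g‖ / (σ.character 1).re ≤ mrChar σ.character := by
    refine le_csSup ((Set.finite_range fun g => ‖σ.character g‖ / (σ.character 1).re).subset
      ?_).bddAbove ⟨g, hg, rfl⟩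
    rintro _ ⟨g, -, rfl⟩
    exact ⟨g, rfl⟩
  rw [character_one_eq] at this
  exact (div_le_iff₀ (by simpa using hm)).mp (by simpa using this)

omit [Finite G] in
theorem mr_nonneg : 0 ≤ mr G :=
  Real.sSup_nonneg (by
    rintro _ ⟨_, ⟨m, σ, -, rfl⟩, -, rfl⟩
    exact mrChar_nonneg σ)

theorem mrChar_le_mr (hσ : σ.IsIrreducible) (h1 : m ≠ 1) : mrChar σ.character ≤ mr G := by
  -- The uniform bound 1 on ratios makes the supremum meaningful without finiteness of Irr(G).
  refine le_csSup ⟨1, ?_⟩ ⟨_, ⟨m, σ, hσ, rfl⟩, ?_, rfl⟩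
  · rintro _ ⟨_, ⟨m, σ, -, rfl⟩, -, rfl⟩
    exact mrChar_le_one σ
  · rw [character_one_eq]
    exact_mod_cast h1

theorem norm_character_eq_of_dim_one (hm : m = 1) (g : G) : ‖σ.character g‖ = m := by
  subst hm
  have hf : (σ g) ^ Nat.card G = 1 := by rw [← map_pow, pow_card_eq_one' (G := G), map_one]
  have hcard := card_roots_charpoly (f := σ g)
  rw [finrank_fin_fun] at hcard
  obtain ⟨z, hz⟩ := Multiset.card_eq_one.mp hcard
  rw [Representation.character, trace_eq_sum_roots, hz, Multiset.sum_singleton,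
    norm_eq_one_of_mem_roots_charpoly Nat.card_pos.ne' hf (hz ▸ Multiset.mem_singleton_self z)]
  simp

omit [Finite G] in
theorem nontrivial_of_isIrreducible {σ : Representation ℂ G (Fin m → ℂ)} (hσ : σ.IsIrreducible) :
    Nontrivial (Fin m → ℂ) := by
  by_contra h
  rw [not_nontrivial_iff_subsingleton] at h
  obtain ⟨x, y, hxy⟩ := hσ.toNontrivial.exists_pair_ne
  exact hxy (Subrepresentation.toSubmodule_injective (Subsingleton.elim _ _))

/-- The inner product is the dimension of the space of intertwining maps, and a nonzero map from an
irreducible is injective. -/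
theorem exists_injective_intertwining [Fintype G] {n : ℕ} (U : Representation ℂ G (Fin n → ℂ))
    (hσ : σ.IsIrreducible) (hU : ∀ g, U.character g⁻¹ = star (U.character g))
    (h : classInner σ.character U.character ≠ 0) :
    ∃ φ : (Fin m → ℂ) →ₗ[ℂ] (Fin n → ℂ), Function.Injective φ ∧
      ∀ x w, φ (σ x w) = U x (φ w) := by
  have : Invertible (Nat.card G : ℂ) := invertibleOfNonzero (by exact_mod_cast Nat.card_pos.ne')
  have h1 := Representation.card_inv_mul_sum_char_mul_char_eq_finrank σ U
  have h2 : classInner σ.character U.character =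
      (Nat.card G : ℂ)⁻¹ * ∑ g : G, U.character g * σ.character g⁻¹ := by
    rw [classInner, finsum_eq_sum_of_fintype]
    congr 1
    refine Fintype.sum_equiv (Equiv.inv G) _ _ fun g => ?_
    rw [Equiv.inv_apply, inv_inv, hU, mul_comm]
    rfl
  rw [h2, h1] at h
  have hpos : 0 < finrank ℂ (Representation.IntertwiningMap σ U) :=
    Nat.pos_of_ne_zero fun h0 => h (by rw [h0, Nat.cast_zero])
  have := finrank_pos_iff.mp hpos
  obtain ⟨φ, hφ⟩ := exists_ne (0 : Representation.IntertwiningMap σ U)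
  exact ⟨φ.toLinearMap, (Representation.IsIrreducible.injective_or_eq_zero φ).resolve_right hφ,
    fun x w => LinearMap.congr_fun (φ.isIntertwining' x) w⟩

end CharacterRatios

/-! ### The two lower bounds on the support -/

section Main

theorem natCast_ne_zero_of_coprime_natCard (K V : Type*) [Field K] [Finite K] [AddCommGroup V]
    [Module K V] [FiniteDimensional K V] [Nontrivial V] {N : ℕ} (h : Nat.Coprime N (Nat.card V)) :
    (N : K) ≠ 0 := by
  intro h0
  have := Fintype.ofFinite K
  have h1 : ringChar K ∣ N := ringChar.dvd h0
  have h2 : ringChar K ∣ Nat.card K := ringChar.dvd (by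
    rw [Nat.card_eq_fintype_card, Nat.cast_card_eq_zero])
  have h3 : ringChar K ∣ Nat.card V := by
    rw [Module.natCard_eq_pow_finrank (K := K)]
    exact h2.trans (dvd_pow_self _ finrank_pos.ne')
  exact CharP.ringChar_ne_one (Nat.eq_one_of_dvd_coprimes h h1 h3)

/-- Multiplicativity off the powers of l is not required: the lift only evaluates θ at eigenvalues,
which are such powers. -/
theorem exists_extend_pow {F : Type*} [Field F] {l : F} {ζ : ℂ} {N : ℕ} (hN : 0 < N)
    (hl : IsPrimitiveRoot l N) (hζ : IsPrimitiveRoot ζ N) :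
    ∃ θ : F → ℂ, ∀ a : ℕ, θ (l ^ a) = ζ ^ a := by
  refine ⟨Function.extend (fun a : ℕ => l ^ a) (fun a => ζ ^ a) 0, fun a => ?_⟩
  refine Function.FactorsThrough.extend_apply (f := fun a : ℕ => l ^ a) ?_ _ a
  intro a b hab
  have hab' : l ^ (a % N) = l ^ (b % N) := by
    rw [hl.eq_orderOf, pow_mod_orderOf, pow_mod_orderOf]; exact hab
  have h := hl.pow_inj (Nat.mod_lt a hN) (Nat.mod_lt b hN) hab'
  change ζ ^ a = ζ ^ b
  rw [← pow_mod_orderOf ζ a, ← pow_mod_orderOf ζ b, ← hζ.eq_orderOf, h]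

theorem exists_minSupp_eq {K V : Type*} [Field K] [AddCommGroup V] [Module K V]
    {G : Subgroup (LinearMap.GeneralLinearGroup K V)} (hG : ¬ ∀ a b : G, a * b = b * a) :
    ∃ g : G, g ≠ 1 ∧ minSupp G = supp (g : LinearMap.GeneralLinearGroup K V) := by
  -- Non-commutativity supplies a non-identity element, so the infimum is attained and is not the
  -- default 0.
  have hne : {s | ∃ g ∈ G, g ≠ 1 ∧ s = supp g}.Nonempty := by
    by_contra! hempty
    refine hG fun a b => ?_
    have h1 : ∀ x : G, x = 1 := by
      intro x
      by_contra hx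
      have : supp (x : LinearMap.GeneralLinearGroup K V) ∈
          {s | ∃ g ∈ G, g ≠ 1 ∧ s = supp g} := ⟨x, x.2, fun h => hx (Subtype.ext h), rfl⟩
      rw [hempty] at this
      exact this
    rw [h1 a, h1 b]
  obtain ⟨g, hg, hg1, hs⟩ := Nat.sInf_mem hne
  exact ⟨⟨g, hg⟩, fun h => hg1 (congrArg Subtype.val h), hs⟩

variable {K V : Type*} [Field K] [AddCommGroup V] [Module K V] [FiniteDimensional K V]
  {G : Subgroup (LinearMap.GeneralLinearGroup K V)} [Finite G]
  {U : Representation ℂ G (Fin (finrank K V) → ℂ)}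

omit [FiniteDimensional K V] in
theorem IsFaithfulLift.mul_one_sub_mr_le_supp (hU : IsFaithfulLift G U)
    (hirr : (natRep G).IsIrreducible) {g : G} (hg : g ≠ 1) :
    (finrank K V : ℝ) / 2 * (1 - mr G) ≤ supp (g : LinearMap.GeneralLinearGroup K V) := by
  by_cases hs : supp (g : LinearMap.GeneralLinearGroup K V) = finrank K V
  · rw [hs]
    have := mul_nonneg (Nat.cast_nonneg (α := ℝ) (finrank K V)) (mr_nonneg (G := G))
    have := Nat.cast_nonneg (α := ℝ) (finrank K V)
    linarith
  have hle : ‖U.character g‖ ≤ mr G * finrank K V := by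
    refine norm_character_le_of_irreducible U g _ fun m σ φ hσ hφ hcomm => ?_
    have := nontrivial_of_isIrreducible hσ
    have hnorm : ‖σ.character g‖ ≠ m := fun h =>
      hs (hU.supp_eq_finrank hirr hφ hcomm hg (by rw [h, finrank_fin_fun]))
    refine (norm_le_mrChar_mul σ (mt (mem_charCenter_iff σ g).mp hnorm)).trans ?_
    exact mul_le_mul_of_nonneg_right
      (mrChar_le_mr σ hσ fun h => hnorm (norm_character_eq_of_dim_one σ h g)) (Nat.cast_nonneg m)
  have hge := hU.norm_character_ge (σ := U) (φ := LinearMap.id) Function.injective_id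
    (fun _ _ => rfl) g
  rw [finrank_fin_fun] at hge
  linarith

omit [FiniteDimensional K V] in
theorem IsFaithfulLift.character_one_sub_maxOffCenter_le_supp (hU : IsFaithfulLift G U)
    (hirr : (natRep G).IsIrreducible) {m : ℕ} {σ : Representation ℂ G (Fin m → ℂ)}
    (hσ : σ.IsIrreducible) {φ : (Fin m → ℂ) →ₗ[ℂ] (Fin (finrank K V) → ℂ)}
    (hφ : Function.Injective φ) (hcomm : ∀ x w, φ (σ x w) = U x (φ w)) {g : G} (hg : g ≠ 1) :
    1 / 2 * ((σ.character 1).re - maxOffCenter σ.character) ≤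
      supp (g : LinearMap.GeneralLinearGroup K V) := by
  have := nontrivial_of_isIrreducible hσ
  have h1 : (σ.character 1).re = m := by rw [character_one_eq, Complex.natCast_re]
  rw [h1]
  by_cases hs : ‖σ.character g‖ = m
  · rw [hU.supp_eq_finrank hirr hφ hcomm hg (by rw [hs, finrank_fin_fun])]
    have h2 := LinearMap.finrank_le_finrank_of_injective hφ
    rw [finrank_fin_fun, finrank_fin_fun] at h2
    have h3 : (m : ℝ) ≤ finrank K V := by exact_mod_cast h2
    have h4 := maxOffCenter_nonneg σ.character
    have h5 := Nat.cast_nonneg (α := ℝ) m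
    linarith
  · have h2 := norm_le_maxOffCenter (mt (mem_charCenter_iff σ g).mp hs)
    have h3 := hU.norm_character_ge hφ hcomm g
    rw [finrank_fin_fun] at h3
    linarith

end Main

end CoprimeLinear

open CoprimeLinear in
theorem lemma2p2 {K V : Type*} [Field K] [Finite K] [AddCommGroup V] [Module K V]
    [FiniteDimensional K V] (G : Subgroup (LinearMap.GeneralLinearGroup K V))
    (hnonab : ¬ ∀ a b : G, a * b = b * a)
    (hcoprime : Nat.Coprime (Nat.card G) (Nat.card V))
    (hirr : (CoprimeLinear.natRep G).IsIrreducible) :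
    (Module.finrank K V : ℝ) / 2 * (1 - CoprimeLinear.mr G) ≤ (CoprimeLinear.minSupp G : ℝ) ∧
    ∀ θ : AlgebraicClosure K →*₀ ℂ, Function.Injective θ →
      ∀ χ ∈ CoprimeLinear.Irr G,
        CoprimeLinear.classInner χ (CoprimeLinear.brauerCharacter G θ) ≠ 0 →
        1 / 2 * ((χ 1).re - CoprimeLinear.maxOffCenter χ) ≤ (CoprimeLinear.minSupp G : ℝ) := by
  have : Finite V := Module.finite_of_finite K
  have : Finite (V →ₗ[K] V) := Finite.of_injective _ DFunLike.coe_injective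
  have : Finite (LinearMap.GeneralLinearGroup K V) := Finite.of_injective _ Units.val_injective
  have : Nontrivial V := by
    by_contra h
    rw [not_nontrivial_iff_subsingleton] at h
    obtain ⟨x, y, hxy⟩ := hirr.toNontrivial.exists_pair_ne
    exact hxy (Subrepresentation.toSubmodule_injective (Subsingleton.elim _ _))
  have := Fintype.ofFinite G
  have hcard : (Nat.card G : K) ≠ 0 := natCast_ne_zero_of_coprime_natCard K V hcoprime
  have : NeZero (Nat.card G : AlgebraicClosure K) := ⟨by
    rw [← map_natCast (algebraMap K (AlgebraicClosure K))]
    exact (_root_.map_ne_zero _).mpr hcard⟩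
  obtain ⟨l, hl⟩ := HasEnoughRootsOfUnity.exists_primitiveRoot (AlgebraicClosure K) (Nat.card G)
  obtain ⟨g, hg, hmin⟩ := exists_minSupp_eq hnonab
  rw [hmin]
  refine ⟨?_, ?_⟩
  · have hζ := Complex.isPrimitiveRoot_exp (Nat.card G) Nat.card_pos.ne'
    obtain ⟨θ, hθ⟩ := exists_extend_pow Nat.card_pos hl hζ
    obtain ⟨U, hU, -, -⟩ := exists_faithfulLift hcard hl hζ hθ
    exact hU.mul_one_sub_mr_le_supp hirr hg
  · rintro θ hθ _ ⟨m, σ, hσ, rfl⟩ hinner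
    -- Taking ζ = θ(l), again a primitive root, makes the character of the lift equal to the given
    -- Brauer character.
    obtain ⟨U, hU, hstar, hchar⟩ := exists_faithfulLift (θ := θ) hcard hl
      (hl.map_of_injective hθ) fun a => map_pow θ l a
    have hβ : brauerCharacter G θ = U.character := funext fun x => (hchar x).symm
    rw [hβ] at hinner
    obtain ⟨φ, hφ, hcomm⟩ := exists_injective_intertwining σ U hσ hstar hinner
    exact hU.character_one_sub_maxOffCenter_le_supp hirr hσ hφ hcomm hg
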